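/- **Theorem (Consistency of posterior expectations in persistent sampling).** *Setting.* Let $\Theta$ be a measurable space, $\pi$ a prior probability measure on $\Theta$, and $\mathcal L:\Theta\to(0,\infty)$ a measurable likelihood. Let $T\ge 2$, let $0=\beta_1<\dots<\beta_T=1$ be a fixed (deterministic) temperature schedule, and put $$\mathcal Z_t=\int \mathcal L^{\beta_t}\,d\pi,\qquad p_t(d\theta)=\frac{\mathcal L(\theta)^{\beta_t}}{\mathcal Z_t}\,\pi(d\theta),\qquad \mathcal P(d\theta)=\frac{\mathcal L(\theta)}{\int \mathcal L\,d\pi}\,\pi(d\theta)=p_T(d\theta).$$ For each $t\le T$ let $\mathcal K_t$ be a Markov kernel on $\Theta$ with invariant distribution $p_t$. *Algorithm.* Persistent sampling (PS) with $N$ particles draws $\theta_1^1,\dots,\theta_1^N$ i.i.d. from $\pi$ and sets $\hat{\mathcal Z}_1=1$. At iteration $t=2,\dots,T$ it assigns to the particles $\theta_{t'}^i$ of all previous generations ($1\le t'\le t-1$, $1\le i\le N$) the weights $$w_{tt'}^i=\frac{\mathcal L(\theta_{t'}^i)^{\beta_t}}{\frac1{t-1}\sum_{s=1}^{t-1}\mathcal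 L(\theta_{t'}^i)^{\beta_s}\hat{\mathcal Z}_s^{-1}},\qquad \hat{\mathcal Z}_t=\frac1{t-1}\sum_{t'=1}^{t-1}\frac1N\sum_{i=1}^N w_{tt'}^i,\qquad W_{tt'}^i=\frac{w_{tt'}^i}{\hat{\mathcal Z}_t},$$ and then, independently for $i=1,\dots,N$ given the past, draws $\tilde\theta_t^i$ from all $(t-1)N$ previous particles with probabilities $W_{tt'}^j/((t-1)N)$ and $\theta_t^i\sim\mathcal K_t(\tilde\theta_t^i,\cdot)$. *Conditions.* - (C1) For all $s,t\le T$: $\sup_{\theta}\mathcal L(\theta)^{\beta_t}/\mathcal L(\theta)^{\beta_s}<\infty$. - (C2) There is $\epsilon>0$ with $\mathcal Z_t\ge\epsilon$ for all $t\le T$. - (C3) For each $t\le T$ there are $C_t<\infty$ and $\rho_t\in(0,1)$ with $\sup_{\theta}\|\mathcal K_t^n(\theta,\cdot)-p_t\|_{TV}\le C_t\rho_t^n$ for all $n\ge1$. - (C4) There is $\delta>0$ with $\beta_t-\beta_{t-1}\ge\delta$ for $2\le t\le T$. - (C5) $f:\Theta\to\mathbb R$ is measurable and $\sup_\theta|f(\theta)|<\infty$.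 *Conclusion.* Under (C1)–(C5), the PS estimator built from all persistent particles with the weights of the final iteration, $$\hat\mu_N(f)=\frac1{(T-1)N}\sum_{t'=1}^{T-1}\sum_{i=1}^N W_{Tt'}^i\,f(\theta_{t'}^i),$$ converges in probability to the posterior expectation: for every $\varepsilon>0$, $\Pr\big(|\hat\mu_N(f)-\mathbb E_{\mathcal P}[f]|\ge\varepsilon\big)\to0$ as $N\to\infty$. -/

import Mathlib

open MeasureTheory ProbabilityTheory Filter Topology
open scoped ENNReal

/-- The input data of a persistent-sampling (PS) run, iterations being numbered from `0`: the
temperature `β t`, the annealed target and the kernel `K t` with index `t` are those of the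
`(t + 1)`-st iteration. In this way iteration `t` has exactly the `t` predecessors `0, …, t - 1`. -/
structure PSModel (Θ : Type*) [MeasurableSpace Θ] where
  /-- the prior distribution -/
  prior : Measure Θ
  prior_prob : IsProbabilityMeasure prior
  /-- the likelihood function -/
  L : Θ → ℝ
  measurable_L : Measurable L
  L_pos : ∀ θ, 0 < L θ
  /-- the temperature schedule -/
  β : ℕ → ℝ
  /-- the MCMC transition kernels -/
  K : ℕ → Kernel Θ Θ
  markov_K : ∀ t, IsMarkovKernel (K t)

/-- Total variation distance `sup_A |μ A - ν A|` of two probability measures. -/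
noncomputable def tvDist {Θ : Type*} [MeasurableSpace Θ] (μ ν : Measure Θ) : ℝ :=
  ⨆ A : {A : Set Θ // MeasurableSet A}, |μ.real A.1 - ν.real A.1|

namespace PSModel

variable {Θ : Type*} [MeasurableSpace Θ]

/-- The normalizing constant `Z_t = ∫ L ^ β_t dπ`. -/
noncomputable def Z (M : PSModel Θ) (t : ℕ) : ℝ := ∫ θ, M.L θ ^ M.β t ∂M.prior

/-- The annealed target `p_t = L ^ β_t π / Z_t`. -/
noncomputable def target (M : PSModel Θ) (t : ℕ) : Measure Θ :=
  M.prior.withDensity fun θ => ENNReal.ofReal (M.L θ ^ M.β t / M.Z t)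

/-- The posterior `L π / ∫ L dπ`. -/
noncomputable def posterior (M : PSModel Θ) : Measure Θ :=
  M.prior.withDensity fun θ => ENNReal.ofReal (M.L θ / ∫ η, M.L η ∂M.prior)

/-! ### The particle weights

A particle history is `x : ℕ → Fin N → Θ`; `x s i` is the `i`-th particle of generation `s`. -/

/-- The estimate of `Z_t` from the generations `0, …, t - 1`, namely `1` for `t = 0` and
otherwise the average of the unnormalized weights of the `t N` earlier particles,
see `Zhat_eq_average`. -/
noncomputable def Zhat (M : PSModel Θ) {N : ℕ} (x : ℕ → Fin N → Θ) : ℕ → ℝ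
  | 0 => 1
  | t + 1 => (1 / ((t + 1 : ℕ) : ℝ)) * ∑ s : Fin (t + 1), (1 / (N : ℝ)) * ∑ i : Fin N,
      M.L (x s i) ^ M.β (t + 1) /
        ((1 / ((t + 1 : ℕ) : ℝ)) *
          ∑ r : Fin (t + 1), M.L (x s i) ^ M.β r * (Zhat M x r)⁻¹)
  termination_by t => t
  decreasing_by exact r.2

/-- The unnormalized weight `w` at iteration `t` of the particle `x s i`, `s < t`: the power
`L ^ β_t` over the equal-weight mixture of the `t` previous (estimated) targets. -/
noncomputable def weight (M : PSModel Θ) {N : ℕ} (x : ℕ → Fin N → Θ) (t s : ℕ) (i : Fin N) : ℝ :=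
  M.L (x s i) ^ M.β t /
    ((1 / (t : ℝ)) * ∑ r ∈ Finset.range t, M.L (x s i) ^ M.β r * (M.Zhat x r)⁻¹)

/-- The importance weight `W = w / Zhat_t` at iteration `t` of the particle `x s i`. These
weights have average one over the `t N` particles of the generations `0, …, t - 1`. -/
noncomputable def normWeight (M : PSModel Θ) {N : ℕ} (x : ℕ → Fin N → Θ) (t s : ℕ) (i : Fin N) :
    ℝ :=
  M.weight x t s i / M.Zhat x t

/-- The PS estimator of iteration `t`: the mean of `f` over all particles of the generations
`0, …, t - 1`, weighted by `W` scaled by `1 / (t N)` to have total mass one. -/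
noncomputable def estimator (M : PSModel Θ) {N : ℕ} (x : ℕ → Fin N → Θ) (t : ℕ) (f : Θ → ℝ) : ℝ :=
  ∑ s ∈ Finset.range t, ∑ i : Fin N, M.normWeight x t s i / (t * N : ℝ) * f (x s i)

/-! ### The sampling steps -/

/-- The law of one particle drawn (multinomial resampling) from the weighted particles of the
generations `0, …, t - 1`. -/
noncomputable def resampleLaw (M : PSModel Θ) {N : ℕ} (t : ℕ) (x : ℕ → Fin N → Θ) : Measure Θ :=
  ∑ s ∈ Finset.range t, ∑ i : Fin N,
    ENNReal.ofReal (M.normWeight x t s i / (t * N : ℝ)) • Measure.dirac (x s i)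

/-- The law of one particle after resampling and one move by the kernel `K t`. -/
noncomputable def moveLaw (M : PSModel Θ) {N : ℕ} (t : ℕ) (x : ℕ → Fin N → Θ) : Measure Θ :=
  (M.resampleLaw t x).bind (M.K t)

theorem Zhat_eq_average (M : PSModel Θ) {N : ℕ} (x : ℕ → Fin N → Θ) (t : ℕ) :
    M.Zhat x (t + 1) = (1 / ((t + 1 : ℕ) : ℝ)) * ∑ s ∈ Finset.range (t + 1),
      (1 / (N : ℝ)) * ∑ i : Fin N, M.weight x (t + 1) s i := by
  rw [Zhat, ← Fin.sum_univ_eq_sum_range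
    (fun s => (1 / (N : ℝ)) * ∑ i : Fin N, M.weight x (t + 1) s i) (t + 1)]
  simp only [weight, ← Fin.sum_univ_eq_sum_range
    (fun r => M.L (x _ _) ^ M.β r * (M.Zhat x r)⁻¹) (t + 1)]

theorem Zhat_pos (M : PSModel Θ) {N : ℕ} (hN : 0 < N) (x : ℕ → Fin N → Θ) (t : ℕ) :
    0 < M.Zhat x t := by
  have : Nonempty (Fin N) := ⟨⟨0, hN⟩⟩
  have hN' : (0 : ℝ) < N := by exact_mod_cast hN
  induction t using Nat.strong_induction_on with
  | _ t ih =>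
    cases t with
    | zero => simp [Zhat]
    | succ t =>
      rw [Zhat]
      have hp : ∀ (θ : Θ) (b : ℝ), 0 < M.L θ ^ b := fun θ b => Real.rpow_pos_of_pos (M.L_pos θ) b
      refine mul_pos (by positivity) (Finset.sum_pos (fun s _ => ?_) Finset.univ_nonempty)
      refine mul_pos (by positivity) (Finset.sum_pos (fun i _ => ?_) Finset.univ_nonempty)
      refine div_pos (hp _ _) (mul_pos (by positivity) ?_)
      exact Finset.sum_pos (fun r _ => mul_pos (hp _ _) (inv_pos.2 (ih r r.2)))
        Finset.univ_nonempty

theorem weight_nonneg (M : PSModel Θ) {N : ℕ} (x : ℕ → Fin N → Θ) (t s : ℕ) (i : Fin N) :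
    0 ≤ M.weight x t s i := by
  have hN : 0 < N := i.pos
  refine div_nonneg (Real.rpow_nonneg (M.L_pos _).le _) (mul_nonneg (by positivity) ?_)
  exact Finset.sum_nonneg fun r _ =>
    mul_nonneg (Real.rpow_nonneg (M.L_pos _).le _) (inv_nonneg.2 (M.Zhat_pos hN x r).le)

theorem sum_normWeight (M : PSModel Θ) {N : ℕ} (hN : 0 < N) (x : ℕ → Fin N → Θ) (t : ℕ) :
    ∑ s ∈ Finset.range (t + 1), ∑ i : Fin N,
      M.normWeight x (t + 1) s i / (((t + 1 : ℕ) : ℝ) * N) = 1 := by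
  have h := M.Zhat_pos hN x (t + 1)
  have hN' : (0 : ℝ) < N := by exact_mod_cast hN
  have e := M.Zhat_eq_average x t
  rw [← Finset.mul_sum] at e
  simp only [normWeight, div_div]
  simp only [← Finset.sum_div]
  rw [div_eq_one_iff_eq (by positivity), e]
  field_simp

theorem measurable_Zhat (M : PSModel Θ) {N : ℕ} (t : ℕ) :
    Measurable fun x : ℕ → Fin N → Θ => M.Zhat x t := by
  have hL := M.measurable_L
  induction t using Nat.strong_induction_on with
  | _ t ih =>
    cases t with
    | zero => simp [Zhat]
    | succ t =>
      simp only [Zhat]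
      refine measurable_const.mul (Finset.measurable_sum _ fun s _ => measurable_const.mul
        (Finset.measurable_sum _ fun i _ => ?_))
      have hx : Measurable fun x : ℕ → Fin N → Θ => M.L (x s i) := by fun_prop
      refine (hx.pow_const _).div (measurable_const.mul
        (Finset.measurable_sum _ fun r _ => (hx.pow_const _).mul (ih r r.2).inv))

theorem measurable_normWeight (M : PSModel Θ) {N : ℕ} (t s : ℕ) (i : Fin N) :
    Measurable fun x : ℕ → Fin N → Θ => M.normWeight x t s i := by
  have hL := M.measurable_L
  have hx : Measurable fun x : ℕ → Fin N → Θ => M.L (x s i) := by fun_prop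
  refine ((hx.pow_const _).div (measurable_const.mul (Finset.measurable_sum _ fun r _ =>
    (hx.pow_const _).mul (M.measurable_Zhat r).inv))).div (M.measurable_Zhat t)

theorem measurable_resampleLaw (M : PSModel Θ) {N : ℕ} (t : ℕ) :
    Measurable (M.resampleLaw (N := N) t) := by
  refine Measure.measurable_of_measurable_coe _ fun A hA => ?_
  simp only [resampleLaw, Measure.coe_finsetSum, Finset.sum_apply, Measure.smul_apply,
    smul_eq_mul]
  refine Finset.measurable_sum _ fun s _ => Finset.measurable_sum _ fun i _ => ?_
  refine ((M.measurable_normWeight t s i).div_const _).ennreal_ofReal.mul ?_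
  exact (Measure.measurable_coe hA).comp
    (Measure.measurable_dirac.comp ((measurable_pi_apply i).comp (measurable_pi_apply s)))

theorem isProbabilityMeasure_moveLaw (M : PSModel Θ) {N : ℕ} (hN : 0 < N) (t : ℕ)
    (x : ℕ → Fin N → Θ) : IsProbabilityMeasure (M.moveLaw (t + 1) x) := by
  have := M.markov_K (t + 1)
  have : IsProbabilityMeasure (M.resampleLaw (t + 1) x) := by
    constructor
    simp only [resampleLaw, Measure.coe_finsetSum, Finset.sum_apply, Measure.smul_apply,
      smul_eq_mul, measure_univ, mul_one]
    have h0 : ∀ s i, 0 ≤ M.normWeight x (t + 1) s i / (((t + 1 : ℕ) : ℝ) * N) := fun s i =>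
      div_nonneg (div_nonneg (M.weight_nonneg x _ s i) (M.Zhat_pos hN x _).le) (by positivity)
    simp_rw [← ENNReal.ofReal_sum_of_nonneg (fun i _ => h0 _ i)]
    rw [← ENNReal.ofReal_sum_of_nonneg (fun s _ => Finset.sum_nonneg fun i _ => h0 s i),
      M.sum_normWeight hN x t, ENNReal.ofReal_one]
  unfold moveLaw
  infer_instance

theorem measurable_stepLaw (M : PSModel Θ) (N t : ℕ) :
    Measurable fun x : ℕ → Fin N → Θ => Measure.pi fun _ : Fin N => M.moveLaw (t + 1) x := by
  have := fun (x : ℕ → Fin N → Θ) (i : Fin N) => M.isProbabilityMeasure_moveLaw i.pos t x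
  have hm : Measurable fun x : ℕ → Fin N → Θ => M.moveLaw (t + 1) x :=
    (Measure.measurable_bind' (M.K (t + 1)).measurable).comp (M.measurable_resampleLaw (t + 1))
  have : ∀ x : ℕ → Fin N → Θ,
      IsProbabilityMeasure (Measure.pi fun _ : Fin N => M.moveLaw (t + 1) x) := by
    intro x
    have := this x
    infer_instance
  refine Measurable.measure_of_isPiSystem_of_isProbabilityMeasure
    (S := Set.pi Set.univ '' Set.pi Set.univ fun _ : Fin N => {A : Set Θ | MeasurableSet A})
    generateFrom_pi.symm isPiSystem_pi ?_
  rintro _ ⟨A, hA, rfl⟩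
  have e : ∀ x : ℕ → Fin N → Θ, (Measure.pi fun _ : Fin N => M.moveLaw (t + 1) x)
      (Set.univ.pi A) = ∏ i, M.moveLaw (t + 1) x (A i) := by
    intro x
    have := this x
    have := fun i : Fin N => M.isProbabilityMeasure_moveLaw i.pos t x
    exact Measure.pi_pi _ _
  simp_rw [e]
  exact Finset.measurable_prod _ fun i _ =>
    (Measure.measurable_coe (hA i (Set.mem_univ i))).comp hm

/-- Iteration `t + 1` of PS: given the history, `N` new particles are obtained independently by
resampling from the weighted particles of all generations `0, …, t` and moving the result by the
kernel `K (t + 1)`. -/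
noncomputable def stepKernel (M : PSModel Θ) (N t : ℕ) :
    Kernel (ℕ → Fin N → Θ) (Fin N → Θ) where
  toFun x := Measure.pi fun _ : Fin N => M.moveLaw (t + 1) x
  measurable' := M.measurable_stepLaw N t

instance (M : PSModel Θ) (N t : ℕ) : IsMarkovKernel (M.stepKernel N t) := by
  constructor
  intro x
  have := fun i : Fin N => M.isProbabilityMeasure_moveLaw i.pos t x
  change IsProbabilityMeasure (Measure.pi fun _ : Fin N => M.moveLaw (t + 1) x)
  infer_instance

/-- The joint law of the generations `0, …, t` of a PS run with `N` particles. Generation `0`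
is an i.i.d. sample from the prior; the entries of the history after generation `t` are
placeholders (copies of generation `0`), overwritten when that generation is sampled. -/
noncomputable def law (M : PSModel Θ) (N : ℕ) : ℕ → Measure (ℕ → Fin N → Θ)
  | 0 => (Measure.pi fun _ : Fin N => M.prior).map fun y _ => y
  | t + 1 => (law M N t ⊗ₘ M.stepKernel N t).map fun p => Function.update p.1 (t + 1) p.2

instance (M : PSModel Θ) (N t : ℕ) : IsProbabilityMeasure (M.law N t) := by
  have := M.prior_prob
  induction t with
  | zero =>
    exact Measure.isProbabilityMeasure_map
      (measurable_pi_lambda _ fun _ => measurable_id).aemeasurable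
  | succ t ih => exact Measure.isProbabilityMeasure_map measurable_update'.aemeasurable

/-! ### The conditions of the consistency theorem, for a run with `T` iterations -/

/-- All ratios `L ^ β_t / L ^ β_s` are bounded. -/
def LikelihoodRatioBounded (M : PSModel Θ) (T : ℕ) : Prop :=
  ∀ t < T, ∀ s < T, ∃ C : ℝ, ∀ θ, M.L θ ^ M.β t / M.L θ ^ M.β s ≤ C

/-- The normalizing constants are bounded away from zero. -/
def NormalizingConstantPositive (M : PSModel Θ) (T : ℕ) : Prop :=
  ∃ ε : ℝ, 0 < ε ∧ ∀ t < T, ε ≤ M.Z t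

/-- Each kernel `K t` is uniformly geometrically ergodic with limit `p_t`. -/
def KernelRegular (M : PSModel Θ) (T : ℕ) : Prop :=
  ∀ t < T, ∃ C ρ : ℝ, 0 < ρ ∧ ρ < 1 ∧
    ∀ n : ℕ, 1 ≤ n → ∀ θ, tvDist ((M.K t ^ n) θ) (M.target t) ≤ C * ρ ^ n

/-- The increments of the temperature schedule are bounded away from zero. -/
def ScheduleRegular (M : PSModel Θ) (T : ℕ) : Prop :=
  ∃ δ : ℝ, 0 < δ ∧ ∀ t, t + 1 < T → δ ≤ M.β (t + 1) - M.β t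

end PSModel

/-! The proof is an induction over generations: under the law of the run, the plain mean of any
bounded measurable function over generation `s` converges in probability to its integral under
`p_s`.

Suppose this holds for the generations up to `t`. If the weights used the exact constants `Z r`,
their denominator would be the average of the densities of `p_0, …, p_t`. Averaging the limits over
generations cancels it and leaves `∫ L ^ β_(t+1) f dπ` (`mean_integral_mixtureWeight`). Using `Zhat`
instead costs little: the term `r = 0` keeps the denominator above `1 / (t + 1)`, so weights are
Lipschitz in the inverse constants, uniformly in the particle (`abs_mixtureWeight_sub_le`). Taking
`f = 1` gives `Zhat → Z`, and a quotient gives convergence of the estimator to the `p_(t+1)`-mean.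

Given the history, generation `t + 1` is i.i.d. with conditional mean the estimator of `K f`. This
tends to `∫ K f dp_(t+1) = ∫ f dp_(t+1)` by invariance, and Chebyshev bounds the fluctuation
uniformly in the history, which closes the induction. -/

/-! ### Convergence in probability as convergence along a filter. -/

/-- The filter of the sets whose complements have probability tending to zero. A real family
converges along it exactly when it converges in probability. -/
def inProb {Ω : ℕ → Type*} [∀ N, MeasurableSpace (Ω N)] (μ : ∀ N, Measure (Ω N)) :
    Filter (Σ N, Ω N) where
  sets := {S | Tendsto (fun N => μ N {x | ⟨N, x⟩ ∉ S}) atTop (𝓝 0)}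
  univ_sets := by simp
  sets_of_superset {S S'} hS h :=
    tendsto_of_tendsto_of_tendsto_of_le_of_le tendsto_const_nhds hS (fun _ => zero_le)
      fun N => measure_mono fun _ hx hxS => hx (h hxS)
  inter_sets {S S'} hS hS' := by
    have h := Tendsto.add hS hS'
    rw [add_zero] at h
    refine tendsto_of_tendsto_of_tendsto_of_le_of_le tendsto_const_nhds h (fun _ => zero_le)
      fun N => (measure_mono ?_).trans (measure_union_le _ _)
    intro x hx
    simp only [Set.mem_ofPred_eq, Set.mem_inter_iff, not_and_or] at hx
    exact hx

theorem mem_inProb {Ω : ℕ → Type*} [∀ N, MeasurableSpace (Ω N)] {μ : ∀ N, Measure (Ω N)}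
    {S : Set (Σ N, Ω N)} :
    S ∈ inProb μ ↔ Tendsto (fun N => μ N {x | ⟨N, x⟩ ∉ S}) atTop (𝓝 0) := Iff.rfl

/-- Lets sums, products and quotients of limits in probability be handled by the ordinary `Tendsto`
calculus, although the probability space changes with `N`. -/
theorem tendsto_inProb_iff {Ω : ℕ → Type*} [∀ N, MeasurableSpace (Ω N)] {μ : ∀ N, Measure (Ω N)}
    {X : ∀ N, Ω N → ℝ} {c : ℝ} :
    Tendsto (fun p : Σ N, Ω N => X p.1 p.2) (inProb μ) (𝓝 c) ↔
      ∀ ε : ℝ, 0 < ε → Tendsto (fun N => μ N {x | ε ≤ |X N x - c|}) atTop (𝓝 0) := by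
  rw [Metric.tendsto_nhds]
  refine forall₂_congr fun ε _ => ?_
  rw [Filter.Eventually, mem_inProb]
  simp only [Set.mem_ofPred_eq, not_lt, Real.dist_eq]

/-! ### Chebyshev bound and integrals against kernels. -/

/-- Weak law of large numbers with an explicit rate, for a bounded function. -/
theorem measure_pi_mean_sub_integral_ge_le {Θ : Type*} [MeasurableSpace Θ] (μ : Measure Θ)
    [IsProbabilityMeasure μ] {f : Θ → ℝ} (hf : Measurable f) {B : ℝ} (hB : ∀ θ, |f θ| ≤ B)
    {N : ℕ} (hN : 0 < N) {ε : ℝ} (hε : 0 < ε) :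
    (Measure.pi fun _ : Fin N => μ) {y | ε ≤ |(1 / (N : ℝ)) * ∑ i, f (y i) - ∫ θ, f θ ∂μ|} ≤
      ENNReal.ofReal (B ^ 2 / ε ^ 2 / N) := by
  have hN' : (0 : ℝ) < N := by exact_mod_cast hN
  have hfL : MemLp f 2 μ :=
    MemLp.of_bound hf.aestronglyMeasurable B (ae_of_all _ fun θ => by simpa using hB θ)
  have hint : ∀ i : Fin N, Integrable (fun y : Fin N → Θ => f (y i)) (Measure.pi fun _ => μ) :=
    fun i => Integrable.of_bound (hf.comp (measurable_pi_apply i)).aestronglyMeasurable B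
      (ae_of_all _ fun y => by simpa using hB (y i))
  have hsum : MemLp (∑ i : Fin N, fun y : Fin N → Θ => f (y i)) 2 (Measure.pi fun _ => μ) :=
    memLp_finsetSum' _ fun i _ =>
      hfL.comp_measurePreserving (measurePreserving_eval (fun _ : Fin N => μ) i)
  have hvar : Var[fun y : Fin N → Θ => (1 / (N : ℝ)) * ∑ i, f (y i); Measure.pi fun _ => μ] ≤
      B ^ 2 / N := by
    have h1 : Var[∑ i : Fin N, fun y : Fin N → Θ => f (y i); Measure.pi fun _ => μ] =
        N * Var[f; μ] := by
      rw [variance_sum_pi (X := fun _ : Fin N => f) fun _ => hfL]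
      simp
    have h2 : Var[f; μ] ≤ B ^ 2 := by
      -- Popoviciu: a variable with values in `[-B, B]` has variance at most `((B - (-B)) / 2) ^ 2`.
      have := variance_le_sq_of_bounded (μ := μ) (a := -B) (b := B) (X := f)
        (ae_of_all _ fun θ => abs_le.1 (hB θ)) hf.aemeasurable
      simpa using this
    have e : (fun y : Fin N → Θ => (1 / (N : ℝ)) * ∑ i, f (y i)) =
        fun y => (1 / (N : ℝ)) * (∑ i : Fin N, fun y : Fin N → Θ => f (y i)) y := by
      ext y; simp
    rw [e, variance_const_mul, h1]
    calc (1 / (N : ℝ)) ^ 2 * (N * Var[f; μ]) = Var[f; μ] / N := by field_simp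
      _ ≤ B ^ 2 / N := by gcongr
  have hmean : ∫ y : Fin N → Θ, (1 / (N : ℝ)) * ∑ i, f (y i) ∂(Measure.pi fun _ => μ) =
      ∫ θ, f θ ∂μ := by
    rw [integral_const_mul, integral_finsetSum _ fun i _ => hint i]
    simp_rw [integral_comp_eval (μ := fun _ : Fin N => μ) hf.aestronglyMeasurable]
    simp [hN'.ne']
  have hL : MemLp (fun y : Fin N → Θ => (1 / (N : ℝ)) * ∑ i, f (y i)) 2 (Measure.pi fun _ => μ) := by
    have := hsum.const_mul (1 / (N : ℝ))
    simpa using this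
  have := meas_ge_le_variance_div_sq hL hε
  rw [hmean] at this
  refine this.trans (ENNReal.ofReal_le_ofReal ?_)
  rw [div_right_comm]
  gcongr

theorem tendsto_ofReal_const_div_nat (c : ℝ) :
    Tendsto (fun N : ℕ => ENNReal.ofReal (c / N)) atTop (𝓝 0) := by
  have := ENNReal.tendsto_ofReal (tendsto_const_div_atTop_nhds_zero_nat c)
  simpa using this

theorem integral_bind_kernel {α β : Type*} [MeasurableSpace α] [MeasurableSpace β]
    (μ : Measure α) [IsFiniteMeasure μ] (κ : Kernel α β) [IsMarkovKernel κ] {f : β → ℝ}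
    (hf : Measurable f) {B : ℝ} (hB : ∀ b, |f b| ≤ B) :
    ∫ b, f b ∂(μ.bind κ) = ∫ a, ∫ b, f b ∂(κ a) ∂μ := by
  rw [← Measure.snd_compProd, Measure.snd,
    integral_map measurable_snd.aemeasurable hf.aestronglyMeasurable, Measure.integral_compProd]
  exact Integrable.of_bound (hf.comp measurable_snd).aestronglyMeasurable B
    (ae_of_all _ fun y => by simpa using hB y.2)

theorem measurable_integral_kernel {α β : Type*} [MeasurableSpace α] [MeasurableSpace β]
    (κ : Kernel α β) [IsMarkovKernel κ] {f : β → ℝ} (hf : Measurable f) :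
    Measurable fun a => ∫ b, f b ∂(κ a) :=
  (hf.stronglyMeasurable.integral_kernel (κ := κ)).measurable

theorem abs_integral_le_of_bounded {α : Type*} [MeasurableSpace α] (μ : Measure α)
    [IsProbabilityMeasure μ] {f : α → ℝ} {B : ℝ} (hB : ∀ b, |f b| ≤ B) :
    |∫ a, f a ∂μ| ≤ B := by
  have := norm_integral_le_of_norm_le_const (μ := μ) (f := f) (C := B)
    (ae_of_all _ fun y => by simpa using hB y)
  simpa using this

/-! ### Generation means and annealed targets. -/

namespace PSModel

variable {Θ : Type*} [MeasurableSpace Θ]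

/-- The mean of `h` over the particles of generation `s`. -/
noncomputable def genMean {N : ℕ} (h : Θ → ℝ) (s : ℕ) (x : ℕ → Fin N → Θ) : ℝ :=
  (1 / (N : ℝ)) * ∑ i, h (x s i)

theorem measurable_genMean {N : ℕ} {h : Θ → ℝ} (hh : Measurable h) (s : ℕ) :
    Measurable (genMean (N := N) h s) := by
  unfold genMean
  fun_prop

theorem abs_mean_le {N : ℕ} {a : Fin N → ℝ} {b : ℝ} (hb : 0 ≤ b) (h : ∀ i, |a i| ≤ b) :
    |(1 / (N : ℝ)) * ∑ i, a i| ≤ b := by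
  -- For `N = 0` the mean is `0`; only here is `0 ≤ b` needed.
  rcases Nat.eq_zero_or_pos N with rfl | hN
  · simpa using hb
  have hN' : (0 : ℝ) < N := by exact_mod_cast hN
  rw [abs_mul, abs_of_nonneg (by positivity)]
  calc 1 / (N : ℝ) * |∑ i, a i| ≤ 1 / N * ∑ i : Fin N, b := by
        gcongr
        exact (Finset.abs_sum_le_sum_abs _ _).trans (Finset.sum_le_sum fun i _ => h i)
    _ = b := by simp; field_simp

theorem integral_target (M : PSModel Θ) (t : ℕ) (h : Θ → ℝ) :
    ∫ θ, h θ ∂(M.target t) = ∫ θ, M.L θ ^ M.β t * (M.Z t)⁻¹ * h θ ∂M.prior := by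
  have hL := M.measurable_L
  rw [target, integral_withDensity_eq_integral_toReal_smul
    ((hL.pow_const _).div_const _).ennreal_ofReal (ae_of_all _ fun _ => ENNReal.ofReal_lt_top)]
  refine integral_congr_ae (ae_of_all _ fun θ => ?_)
  have h0 : 0 ≤ M.Z t := integral_nonneg fun θ => Real.rpow_nonneg (M.L_pos θ).le _
  simp only [smul_eq_mul]
  rw [ENNReal.toReal_ofReal (div_nonneg (Real.rpow_nonneg (M.L_pos θ).le _) h0), div_eq_mul_inv]

theorem target_eq_posterior (M : PSModel Θ) {t : ℕ} (ht : M.β t = 1) :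
    M.target t = M.posterior := by
  simp [target, posterior, Z, ht]

theorem target_eq_prior (M : PSModel Θ) {t : ℕ} (ht : M.β t = 0) : M.target t = M.prior := by
  have := M.prior_prob
  simp [target, Z, ht]

/-! ### Uniform bounds on the mixture weights. -/

/-- The prior density `L ^ β_t / q` of the annealed target up to `Z_t`, where `q` is the mixture
of the targets `r < t` with normalizing constants `z r`. -/
noncomputable def mixtureWeight (M : PSModel Θ) (z : ℕ → ℝ) (t : ℕ) (θ : Θ) : ℝ :=
  M.L θ ^ M.β t / ((1 / (t : ℝ)) * ∑ r ∈ Finset.range t, M.L θ ^ M.β r * (z r)⁻¹)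

theorem measurable_mixtureWeight (M : PSModel Θ) (z : ℕ → ℝ) (t : ℕ) :
    Measurable (M.mixtureWeight z t) := by
  have hL := M.measurable_L
  unfold mixtureWeight
  fun_prop

theorem weight_eq_mixtureWeight (M : PSModel Θ) {N : ℕ} (x : ℕ → Fin N → Θ) (t s : ℕ)
    (i : Fin N) : M.weight x t s i = M.mixtureWeight (M.Zhat x) t (x s i) := rfl

/-- The term `r = 0` equals `1`, since `β 0 = 0` and `z 0 = 1`, and the others are nonnegative. -/
theorem mixture_ge (M : PSModel Θ) (h0 : M.β 0 = 0) {z : ℕ → ℝ} (hz0 : z 0 = 1)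
    (hz : ∀ r, 0 ≤ z r) (t : ℕ) (θ : Θ) :
    1 / ((t + 1 : ℕ) : ℝ) ≤
      (1 / ((t + 1 : ℕ) : ℝ)) * ∑ r ∈ Finset.range (t + 1), M.L θ ^ M.β r * (z r)⁻¹ := by
  refine le_mul_of_one_le_right (by positivity) ?_
  rw [Finset.sum_range_succ']
  simp only [h0, hz0, Real.rpow_zero, inv_one, mul_one]
  exact le_add_of_nonneg_left (Finset.sum_nonneg fun r _ =>
    mul_nonneg (Real.rpow_nonneg (M.L_pos θ).le _) (inv_nonneg.2 (hz _)))

theorem abs_mixtureWeight_le (M : PSModel Θ) (h0 : M.β 0 = 0) {z : ℕ → ℝ} (hz0 : z 0 = 1)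
    (hz : ∀ r, 0 ≤ z r) {t : ℕ} {C : ℝ} (hC : ∀ θ, M.L θ ^ M.β (t + 1) ≤ C) (θ : Θ) :
    |M.mixtureWeight z (t + 1) θ| ≤ C * (t + 1 : ℕ) := by
  have h1 := M.mixture_ge h0 hz0 hz t θ
  have hL := Real.rpow_pos_of_pos (M.L_pos θ) (M.β (t + 1))
  have hp : (0 : ℝ) < 1 / ((t + 1 : ℕ) : ℝ) := by positivity
  rw [mixtureWeight, abs_of_nonneg (div_nonneg hL.le (hp.le.trans h1))]
  refine (div_le_div₀ (hL.le.trans (hC θ)) (hC θ) hp h1).trans (by simp)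

/-- Writes `a / q - a / q'` as `a (q' - q) / (q q')` with both denominators at least `1 / (t + 1)`.
The bound is free of `θ`, so it applies at random particles and to the random constants `Zhat`. -/
theorem abs_mixtureWeight_sub_le (M : PSModel Θ) (h0 : M.β 0 = 0) {z z' : ℕ → ℝ} (hz0 : z 0 = 1)
    (hz : ∀ r, 0 ≤ z r) (hz0' : z' 0 = 1) (hz' : ∀ r, 0 ≤ z' r) {t : ℕ} {C : ℝ}
    (hC : ∀ r ≤ t + 1, ∀ θ, M.L θ ^ M.β r ≤ C) (θ : Θ) :
    |M.mixtureWeight z (t + 1) θ - M.mixtureWeight z' (t + 1) θ| ≤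
      C * (t + 1 : ℕ) * (C * ∑ r ∈ Finset.range (t + 1), |(z' r)⁻¹ - (z r)⁻¹|) := by
  have h1 := M.mixture_ge h0 hz0 hz t θ
  have h1' := M.mixture_ge h0 hz0' hz' t θ
  have hL := Real.rpow_pos_of_pos (M.L_pos θ) (M.β (t + 1))
  have hp : (0 : ℝ) < 1 / ((t + 1 : ℕ) : ℝ) := by positivity
  unfold mixtureWeight
  set n : ℝ := ((t + 1 : ℕ) : ℝ) with hn
  have hn0 : 0 < n := by rw [hn]; positivity
  set q := (1 / n) * ∑ r ∈ Finset.range (t + 1), M.L θ ^ M.β r * (z r)⁻¹ with hq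
  set q' := (1 / n) * ∑ r ∈ Finset.range (t + 1), M.L θ ^ M.β r * (z' r)⁻¹ with hq'
  have hC0 : 0 ≤ C := hL.le.trans (hC _ le_rfl θ)
  have hqp := hp.trans_le h1
  have hqp' := hp.trans_le h1'
  have hd : |q' - q| ≤ (1 / n) * (C * ∑ r ∈ Finset.range (t + 1), |(z' r)⁻¹ - (z r)⁻¹|) := by
    rw [hq, hq', ← mul_sub, ← Finset.sum_sub_distrib, abs_mul, abs_of_pos hp, Finset.mul_sum]
    gcongr
    refine (Finset.abs_sum_le_sum_abs _ _).trans (Finset.sum_le_sum fun r hr => ?_)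
    rw [← mul_sub, abs_mul, abs_of_pos (Real.rpow_pos_of_pos (M.L_pos θ) _)]
    gcongr
    exact hC r (by have := Finset.mem_range.1 hr; omega) θ
  have e : M.L θ ^ M.β (t + 1) / q - M.L θ ^ M.β (t + 1) / q' =
      M.L θ ^ M.β (t + 1) * (1 / q) * (1 / q') * (q' - q) := by
    field_simp
  have i1 : 1 / q ≤ n := by
    simpa using one_div_le_one_div_of_le hp h1
  have i1' : 1 / q' ≤ n := by
    simpa using one_div_le_one_div_of_le hp h1'
  rw [e, abs_mul, abs_of_nonneg (by positivity)]
  calc M.L θ ^ M.β (t + 1) * (1 / q) * (1 / q') * |q' - q|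
      ≤ C * n * n * ((1 / n) * (C * ∑ r ∈ Finset.range (t + 1), |(z' r)⁻¹ - (z r)⁻¹|)) := by
        gcongr
        exact hC _ le_rfl θ
    _ = _ := by field_simp

/-! ### Limits of the weighted means along a filter. -/

/-- The mean of `f` over all particles of the generations `0, …, t - 1` with unnormalized
weights. -/
noncomputable def weightedMean (M : PSModel Θ) {N : ℕ} (x : ℕ → Fin N → Θ) (t : ℕ)
    (f : Θ → ℝ) : ℝ :=
  (1 / (t : ℝ)) * ∑ s ∈ Finset.range t, (1 / (N : ℝ)) * ∑ i, M.weight x t s i * f (x s i)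

theorem estimator_eq_weightedMean_div (M : PSModel Θ) {N : ℕ} (x : ℕ → Fin N → Θ) (t : ℕ)
    (f : Θ → ℝ) : M.estimator x t f = M.weightedMean x t f / M.Zhat x t := by
  simp only [estimator, weightedMean, normWeight, Finset.mul_sum, Finset.sum_div]
  refine Finset.sum_congr rfl fun s _ => Finset.sum_congr rfl fun i _ => ?_
  simp only [div_eq_mul_inv, mul_inv]
  ring

theorem weightedMean_one (M : PSModel Θ) {N : ℕ} (x : ℕ → Fin N → Θ) (t : ℕ) :
    M.weightedMean x (t + 1) (fun _ => 1) = M.Zhat x (t + 1) := by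
  simp only [weightedMean, mul_one, Zhat_eq_average]

/-- The mean over the generations of the limits of the generation means is the integral against
`L ^ β_t` under the prior. -/
theorem mean_integral_mixtureWeight (M : PSModel Θ) (h0 : M.β 0 = 0) {t : ℕ} {C : ℝ}
    (hC : ∀ r ≤ t + 1, ∀ θ, M.L θ ^ M.β r ≤ C) (hZ0 : M.Z 0 = 1) (hZ : ∀ r, 0 ≤ M.Z r)
    {f : Θ → ℝ} (hf : Measurable f) {B : ℝ} (hB : ∀ θ, |f θ| ≤ B) :
    (1 / ((t + 1 : ℕ) : ℝ)) * ∑ s ∈ Finset.range (t + 1),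
        ∫ θ, M.mixtureWeight M.Z (t + 1) θ * f θ ∂(M.target s) =
      ∫ θ, M.L θ ^ M.β (t + 1) * f θ ∂M.prior := by
  have := M.prior_prob
  have hL := M.measurable_L
  have hm := M.measurable_mixtureWeight M.Z (t + 1)
  simp_rw [integral_target]
  rw [← integral_finsetSum, ← integral_const_mul]
  · refine integral_congr_ae (ae_of_all _ fun θ => ?_)
    have h1 := M.mixture_ge h0 hZ0 hZ t θ
    have hq := (show (0 : ℝ) < 1 / ((t + 1 : ℕ) : ℝ) by positivity).trans_le h1
    simp only [mixtureWeight]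
    -- The densities of the targets sum to the same `S` that stands in the denominator of the
    -- weight.
    rw [← Finset.sum_mul]
    set S := ∑ r ∈ Finset.range (t + 1), M.L θ ^ M.β r * (M.Z r)⁻¹ with hS
    have hS0 : S ≠ 0 := fun h => by simp [h] at hq
    field_simp
  · intro s hs
    refine Integrable.of_bound (by fun_prop) (C * |(M.Z s)⁻¹| * (C * (t + 1 : ℕ) * B))
      (ae_of_all _ fun θ => ?_)
    have hp := Real.rpow_pos_of_pos (M.L_pos θ) (M.β s)
    have hs' := hC s (by have := Finset.mem_range.1 hs; omega) θ
    have hw := M.abs_mixtureWeight_le h0 hZ0 hZ (hC (t + 1) le_rfl) θ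
    rw [Real.norm_eq_abs, abs_mul, abs_mul, abs_mul, abs_of_pos hp]
    have hb := hB θ
    have hC0 : 0 ≤ C := hp.le.trans hs'
    gcongr

/-- With `Z` in place of `Zhat` the weight is a fixed bounded function, to which `hgen` applies; the
replacement error is controlled by `hZhat`. -/
theorem tendsto_weightedMean (M : PSModel Θ) (h0 : M.β 0 = 0) {t : ℕ} {C : ℝ}
    (hC : ∀ r ≤ t + 1, ∀ θ, M.L θ ^ M.β r ≤ C) (hZ0 : M.Z 0 = 1) (hZ : ∀ r, 0 ≤ M.Z r)
    (hZpos : ∀ r ≤ t, 0 < M.Z r) {F : Filter (Σ N, ℕ → Fin N → Θ)}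
    (hgen : ∀ s ≤ t, ∀ f : Θ → ℝ, Measurable f → (∃ B : ℝ, ∀ θ, |f θ| ≤ B) →
      Tendsto (fun p : Σ N, ℕ → Fin N → Θ => genMean f s p.2) F (𝓝 (∫ θ, f θ ∂M.target s)))
    (hZhat : ∀ r ≤ t, Tendsto (fun p : Σ N, ℕ → Fin N → Θ => M.Zhat p.2 r) F (𝓝 (M.Z r)))
    {f : Θ → ℝ} (hf : Measurable f) {B : ℝ} (hB : ∀ θ, |f θ| ≤ B) :
    Tendsto (fun p : Σ N, ℕ → Fin N → Θ => M.weightedMean p.2 (t + 1) f) F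
      (𝓝 (∫ θ, M.L θ ^ M.β (t + 1) * f θ ∂M.prior)) := by
  have hm := M.measurable_mixtureWeight M.Z (t + 1)
  have hlim : Tendsto (fun p : Σ N, ℕ → Fin N → Θ => (1 / ((t + 1 : ℕ) : ℝ)) *
      ∑ s ∈ Finset.range (t + 1), genMean (fun θ => M.mixtureWeight M.Z (t + 1) θ * f θ) s p.2) F
      (𝓝 (∫ θ, M.L θ ^ M.β (t + 1) * f θ ∂M.prior)) := by
    rw [← M.mean_integral_mixtureWeight h0 hC hZ0 hZ hf hB]
    refine (tendsto_finsetSum _ fun s hs => ?_).const_mul _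
    refine hgen s (Nat.lt_succ_iff.1 (Finset.mem_range.1 hs)) _ (hm.mul hf)
      ⟨C * (t + 1 : ℕ) * B, fun θ => ?_⟩
    rw [abs_mul]
    exact mul_le_mul (M.abs_mixtureWeight_le h0 hZ0 hZ (hC (t + 1) le_rfl) θ) (hB θ)
      (abs_nonneg _) ((abs_nonneg _).trans (M.abs_mixtureWeight_le h0 hZ0 hZ (hC _ le_rfl) θ))
  -- Lipschitz bound for the weights times the bound on `f`; it depends on the history only through
  -- `Zhat`.
  set D : (Σ N, ℕ → Fin N → Θ) → ℝ := fun p =>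
    C * (t + 1 : ℕ) * (C * ∑ r ∈ Finset.range (t + 1), |(M.Z r)⁻¹ - (M.Zhat p.2 r)⁻¹|) * B
    with hD
  have hD0 : Tendsto D F (𝓝 0) := by
    have h : Tendsto D F
        (𝓝 (C * (t + 1 : ℕ) * (C * ∑ r ∈ Finset.range (t + 1), |(M.Z r)⁻¹ - (M.Z r)⁻¹|) * B)) := by
      refine (((tendsto_finsetSum _ fun r hr => ?_).const_mul _).const_mul _).mul_const _
      have hr' := Nat.lt_succ_iff.1 (Finset.mem_range.1 hr)
      exact (tendsto_const_nhds.sub ((hZhat r hr').inv₀ (hZpos r hr').ne')).abs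
    simpa using h
  have hdiff : Tendsto (fun p : Σ N, ℕ → Fin N → Θ => M.weightedMean p.2 (t + 1) f -
      (1 / ((t + 1 : ℕ) : ℝ)) * ∑ s ∈ Finset.range (t + 1),
        genMean (fun θ => M.mixtureWeight M.Z (t + 1) θ * f θ) s p.2) F (𝓝 0) := by
    refine squeeze_zero_norm (fun p => ?_) hD0
    obtain ⟨N, x⟩ := p
    have hC0 : ∀ θ : Θ, 0 ≤ C := fun θ =>
      (Real.rpow_pos_of_pos (M.L_pos θ) (M.β 0)).le.trans (hC 0 (by omega) θ)
    have := M.prior_prob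
    -- A point of `Θ` gives `0 ≤ C` and `0 ≤ B` even for `N = 0`, when there is no particle.
    obtain ⟨θ₀⟩ := nonempty_of_isProbabilityMeasure M.prior
    have hC0 := hC0 θ₀
    have hB0 : 0 ≤ B := (abs_nonneg _).trans (hB θ₀)
    have hDn : 0 ≤ D ⟨N, x⟩ := by rw [hD]; positivity
    simp only [weightedMean, genMean]
    rw [← mul_sub, ← Finset.sum_sub_distrib, Real.norm_eq_abs, abs_mul,
      abs_of_nonneg (by positivity)]
    have hle : ∀ s, |1 / (N : ℝ) * ∑ i, M.weight x (t + 1) s i * f (x s i) -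
        1 / (N : ℝ) * ∑ i, M.mixtureWeight M.Z (t + 1) (x s i) * f (x s i)| ≤ D ⟨N, x⟩ := by
      intro s
      rw [← mul_sub, ← Finset.sum_sub_distrib]
      refine abs_mean_le hDn fun i => ?_
      have hh := M.abs_mixtureWeight_sub_le h0 (z := M.Zhat x) (z' := M.Z) (by simp [Zhat])
        (fun r => (M.Zhat_pos i.pos x r).le) hZ0 hZ hC (x s i)
      rw [← sub_mul, abs_mul, weight_eq_mixtureWeight]
      exact mul_le_mul hh (hB _) (abs_nonneg _) ((abs_nonneg _).trans hh)
    calc _ ≤ 1 / ((t + 1 : ℕ) : ℝ) * ∑ s ∈ Finset.range (t + 1), D ⟨N, x⟩ := by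
          gcongr
          exact (Finset.abs_sum_le_sum_abs _ _).trans (Finset.sum_le_sum fun s _ => hle s)
      _ = D ⟨N, x⟩ := by
          rw [Finset.sum_const, Finset.card_range, nsmul_eq_mul]
          field_simp
  simpa using hdiff.add hlim

/-- Strong induction with `f = 1`: `Zhat` at `r + 1` involves only generations and estimates up to
`r`. -/
theorem tendsto_Zhat (M : PSModel Θ) (h0 : M.β 0 = 0) {t : ℕ} {C : ℝ}
    (hC : ∀ r ≤ t + 1, ∀ θ, M.L θ ^ M.β r ≤ C) (hZ0 : M.Z 0 = 1) (hZ : ∀ r, 0 ≤ M.Z r)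
    (hZpos : ∀ r ≤ t, 0 < M.Z r) {F : Filter (Σ N, ℕ → Fin N → Θ)}
    (hgen : ∀ s ≤ t, ∀ f : Θ → ℝ, Measurable f → (∃ B : ℝ, ∀ θ, |f θ| ≤ B) →
      Tendsto (fun p : Σ N, ℕ → Fin N → Θ => genMean f s p.2) F (𝓝 (∫ θ, f θ ∂M.target s)))
    (r : ℕ) (hr : r ≤ t + 1) :
    Tendsto (fun p : Σ N, ℕ → Fin N → Θ => M.Zhat p.2 r) F (𝓝 (M.Z r)) := by
  induction r using Nat.strong_induction_on with
  | _ r ih =>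
    cases r with
    | zero =>
      simp only [Zhat, hZ0]
      exact tendsto_const_nhds
    | succ r =>
      have h := M.tendsto_weightedMean h0 (t := r) (fun q hq => hC q (by omega)) hZ0 hZ
        (fun q hq => hZpos q (by omega)) (fun s hs => hgen s (by omega))
        (fun q hq => ih q (by omega) (by omega)) (f := fun _ => 1) measurable_const
        (B := 1) (by simp)
      simp only [weightedMean_one, mul_one] at h
      exact h

theorem tendsto_estimator (M : PSModel Θ) (h0 : M.β 0 = 0) {t : ℕ} {C : ℝ}
    (hC : ∀ r ≤ t + 1, ∀ θ, M.L θ ^ M.β r ≤ C) (hZ0 : M.Z 0 = 1) (hZ : ∀ r, 0 ≤ M.Z r)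
    (hZpos : ∀ r ≤ t + 1, 0 < M.Z r) {F : Filter (Σ N, ℕ → Fin N → Θ)}
    (hgen : ∀ s ≤ t, ∀ f : Θ → ℝ, Measurable f → (∃ B : ℝ, ∀ θ, |f θ| ≤ B) →
      Tendsto (fun p : Σ N, ℕ → Fin N → Θ => genMean f s p.2) F (𝓝 (∫ θ, f θ ∂M.target s)))
    {f : Θ → ℝ} (hf : Measurable f) {B : ℝ} (hB : ∀ θ, |f θ| ≤ B) :
    Tendsto (fun p : Σ N, ℕ → Fin N → Θ => M.estimator p.2 (t + 1) f) F
      (𝓝 (∫ θ, f θ ∂M.target (t + 1))) := by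
  have hZhat := M.tendsto_Zhat h0 hC hZ0 hZ (fun r hr => hZpos r (by omega)) hgen
  have h := (M.tendsto_weightedMean h0 hC hZ0 hZ (fun r hr => hZpos r (by omega)) hgen
    (fun r hr => hZhat r (by omega)) hf hB).div (hZhat (t + 1) le_rfl) (hZpos (t + 1) le_rfl).ne'
  have e : ∫ θ, f θ ∂M.target (t + 1) =
      (∫ θ, M.L θ ^ M.β (t + 1) * f θ ∂M.prior) / M.Z (t + 1) := by
    rw [integral_target, ← integral_div]
    refine integral_congr_ae (ae_of_all _ fun θ => ?_)
    simp only [div_eq_mul_inv]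
    ring
  rw [e]
  simp only [estimator_eq_weightedMean_div]
  exact h

/-! ### One iteration: resampling, moving, and the joint law. -/

theorem normWeight_nonneg (M : PSModel Θ) {N : ℕ} (x : ℕ → Fin N → Θ) (t s : ℕ) (i : Fin N) :
    0 ≤ M.normWeight x t s i :=
  div_nonneg (M.weight_nonneg x t s i) (M.Zhat_pos i.pos x t).le

/-- Identifies the conditional mean after resampling with the estimator, so consistency of the
estimator drives the next generation. -/
theorem integral_resampleLaw (M : PSModel Θ) {N : ℕ} (t : ℕ) (x : ℕ → Fin N → Θ) {f : Θ → ℝ}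
    (hf : Measurable f) : ∫ θ, f θ ∂(M.resampleLaw t x) = M.estimator x t f := by
  have hi : ∀ s i, Integrable f
      (ENNReal.ofReal (M.normWeight x t s i / (t * N : ℝ)) • Measure.dirac (x s i)) := by
    intro s i
    refine Integrable.smul_measure ?_ ENNReal.ofReal_ne_top
    -- Singletons of `Θ` need not be measurable; the level set of `f` is.
    exact (integrable_const (f (x s i))).congr
      ((ae_dirac_iff (measurableSet_eq_fun measurable_const hf)).2 rfl)
  rw [resampleLaw, estimator, integral_finsetSum_measure fun s _ =>
    integrable_finsetSum_measure.2 fun i _ => hi s i]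
  refine Finset.sum_congr rfl fun s _ => ?_
  rw [integral_finsetSum_measure fun i _ => hi s i]
  refine Finset.sum_congr rfl fun i _ => ?_
  rw [integral_smul_measure, integral_dirac' _ _ hf.stronglyMeasurable,
    ENNReal.toReal_ofReal (div_nonneg (M.normWeight_nonneg x t s i) (by positivity)), smul_eq_mul]

theorem integral_moveLaw (M : PSModel Θ) {N : ℕ} (t : ℕ) (x : ℕ → Fin N → Θ) {f : Θ → ℝ}
    (hf : Measurable f) {B : ℝ} (hB : ∀ θ, |f θ| ≤ B) :
    ∫ θ, f θ ∂(M.moveLaw t x) = M.estimator x t fun θ => ∫ η, f η ∂(M.K t θ) := by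
  have := M.markov_K t
  -- Only finiteness is claimed: for `t = 0` this is the zero measure.
  have : IsFiniteMeasure (M.resampleLaw t x) := by
    constructor
    simp only [resampleLaw, Measure.coe_finsetSum, Finset.sum_apply, Measure.smul_apply,
      smul_eq_mul, measure_univ, mul_one]
    exact ENNReal.sum_lt_top.2 fun s _ => ENNReal.sum_lt_top.2 fun i _ => ENNReal.ofReal_lt_top
  rw [moveLaw, integral_bind_kernel _ _ hf hB,
    integral_resampleLaw _ _ _ (measurable_integral_kernel _ hf)]

theorem law_succ_apply (M : PSModel Θ) {N t : ℕ} {A : Set (ℕ → Fin N → Θ)}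
    (hA : MeasurableSet A) : M.law N (t + 1) A =
      (M.law N t ⊗ₘ M.stepKernel N t) {p | Function.update p.1 (t + 1) p.2 ∈ A} := by
  rw [law, Measure.map_apply measurable_update' hA]
  rfl

theorem compProd_stepKernel_fst (M : PSModel Θ) {N t : ℕ} {A : Set (ℕ → Fin N → Θ)}
    (hA : MeasurableSet A) :
    (M.law N t ⊗ₘ M.stepKernel N t) {p | p.1 ∈ A} = M.law N t A := by
  have h : (M.law N t ⊗ₘ M.stepKernel N t).fst A = M.law N t A := by rw [Measure.fst_compProd]
  rwa [Measure.fst_apply hA] at h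

/-- Sampling generation `t + 1` leaves generation `s` untouched, so the deviation events keep their
probability. -/
theorem tendsto_genMean_law_succ (M : PSModel Θ) {s t : ℕ} (hs : s ≤ t) {f : Θ → ℝ}
    (hf : Measurable f) {c : ℝ}
    (h : Tendsto (fun p : Σ N, ℕ → Fin N → Θ => genMean f s p.2) (inProb fun N => M.law N t)
      (𝓝 c)) :
    Tendsto (fun p : Σ N, ℕ → Fin N → Θ => genMean f s p.2) (inProb fun N => M.law N (t + 1))
      (𝓝 c) := by
  refine (tendsto_inProb_iff (X := fun _ x => genMean f s x)).2 fun ε hε => ?_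
  refine ((tendsto_inProb_iff (X := fun _ x => genMean f s x)).1 h ε hε).congr fun N => ?_
  have hm : MeasurableSet {x : ℕ → Fin N → Θ | ε ≤ |genMean f s x - c|} :=
    measurableSet_le measurable_const ((measurable_genMean hf s).sub_const c).abs
  rw [M.law_succ_apply hm, ← M.compProd_stepKernel_fst hm]
  have e : ∀ p : (ℕ → Fin N → Θ) × (Fin N → Θ),
      genMean f s (Function.update p.1 (t + 1) p.2) = genMean f s p.1 := fun p => by
    simp only [genMean, Function.update_of_ne (show s ≠ t + 1 by omega)]
  simp only [Set.mem_ofPred_eq, e]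

/-- The bound does not depend on the history `x`, so it survives integration over `x`. -/
theorem stepKernel_mean_ge_le (M : PSModel Θ) {N : ℕ} (hN : 0 < N) (t : ℕ) {f : Θ → ℝ}
    (hf : Measurable f) {B : ℝ} (hB : ∀ θ, |f θ| ≤ B) {ε : ℝ} (hε : 0 < ε) (x : ℕ → Fin N → Θ) :
    M.stepKernel N t x {y | ε ≤ |(1 / (N : ℝ)) * ∑ i, f (y i) -
        M.estimator x (t + 1) fun θ => ∫ η, f η ∂(M.K (t + 1) θ)|} ≤
      ENNReal.ofReal (B ^ 2 / ε ^ 2 / N) := by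
  have := M.isProbabilityMeasure_moveLaw hN t x
  rw [← M.integral_moveLaw _ _ hf hB]
  exact measure_pi_mean_sub_integral_ge_le (M.moveLaw (t + 1) x) hf hB hN hε

theorem measurable_estimator (M : PSModel Θ) {N : ℕ} (t : ℕ) {f : Θ → ℝ} (hf : Measurable f) :
    Measurable fun x : ℕ → Fin N → Θ => M.estimator x t f :=
  Finset.measurable_sum _ fun s _ => Finset.measurable_sum _ fun i _ =>
    ((M.measurable_normWeight t s i).div_const _).mul
      (hf.comp ((measurable_pi_apply i).comp (measurable_pi_apply s)))

/-- Conditionally on the history, the mean over the new generation is close to its conditional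
expectation. -/
theorem law_succ_genMean_ge_le (M : PSModel Θ) {N t : ℕ} (hN : 0 < N) {f : Θ → ℝ}
    (hf : Measurable f) {B : ℝ} (hB : ∀ θ, |f θ| ≤ B) {m ε : ℝ} (hε : 0 < ε) :
    M.law N (t + 1) {x | ε ≤ |genMean f (t + 1) x - m|} ≤
      M.law N t {x | ε / 2 ≤ |(M.estimator x (t + 1) fun θ => ∫ η, f η ∂(M.K (t + 1) θ)) - m|} +
        ENNReal.ofReal (B ^ 2 / (ε / 2) ^ 2 / N) := by
  have hmK := M.markov_K (t + 1)
  have hKf := measurable_integral_kernel (M.K (t + 1)) hf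
  obtain ⟨e, he⟩ : ∃ e : (ℕ → Fin N → Θ) → ℝ, e = fun x =>
    M.estimator x (t + 1) fun θ => ∫ η, f η ∂(M.K (t + 1) θ) := ⟨_, rfl⟩
  have hem : Measurable e := he ▸ M.measurable_estimator (t + 1) hKf
  have hstep : ∀ x, M.stepKernel N t x {y | ε / 2 ≤ |(1 / (N : ℝ)) * ∑ i, f (y i) - e x|} ≤
      ENNReal.ofReal (B ^ 2 / (ε / 2) ^ 2 / N) := fun x => by
    rw [he]
    exact M.stepKernel_mean_ge_le hN t hf hB (half_pos hε) x
  have hgoal : {x | ε / 2 ≤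
      |(M.estimator x (t + 1) fun θ => ∫ η, f η ∂(M.K (t + 1) θ)) - m|} =
      {x : ℕ → Fin N → Θ | ε / 2 ≤ |e x - m|} := by rw [he]
  rw [hgoal]
  clear hgoal he
  have hm : MeasurableSet {x : ℕ → Fin N → Θ | ε ≤ |genMean f (t + 1) x - m|} :=
    measurableSet_le measurable_const ((measurable_genMean hf _).sub_const m).abs
  have hm1 : MeasurableSet {x : ℕ → Fin N → Θ | ε / 2 ≤ |e x - m|} :=
    measurableSet_le measurable_const (hem.sub_const m).abs
  have hm2 : MeasurableSet {p : (ℕ → Fin N → Θ) × (Fin N → Θ) |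
      ε / 2 ≤ |(1 / (N : ℝ)) * ∑ i, f (p.2 i) - e p.1|} := by
    refine measurableSet_le measurable_const (Measurable.abs (Measurable.sub ?_ ?_))
    · fun_prop
    · exact hem.comp measurable_fst
  rw [M.law_succ_apply hm, ← M.compProd_stepKernel_fst hm1]
  -- Triangle inequality through the conditional mean `e`, with `ε / 2` for each part.
  have hsub : {p : (ℕ → Fin N → Θ) × (Fin N → Θ) | Function.update p.1 (t + 1) p.2 ∈
      {x : ℕ → Fin N → Θ | ε ≤ |genMean f (t + 1) x - m|}} ⊆
      {p | p.1 ∈ {x : ℕ → Fin N → Θ | ε / 2 ≤ |e x - m|}} ∪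
        {p | ε / 2 ≤ |(1 / (N : ℝ)) * ∑ i, f (p.2 i) - e p.1|} := by
    intro p hp
    simp only [Set.mem_ofPred_eq, genMean, Function.update_self] at hp
    simp only [Set.mem_union, Set.mem_ofPred_eq]
    by_contra! hcon
    have := abs_sub_le ((1 / (N : ℝ)) * ∑ i, f (p.2 i)) (e p.1) m
    linarith [hcon.1, hcon.2]
  refine (measure_mono hsub).trans ((measure_union_le _ _).trans (add_le_add le_rfl ?_))
  rw [Measure.compProd_apply hm2]
  exact (lintegral_mono hstep).trans (by simp)

/-! ### Induction over the generations. -/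

theorem tendsto_genMean_law_zero (M : PSModel Θ) {f : Θ → ℝ} (hf : Measurable f) {B : ℝ}
    (hB : ∀ θ, |f θ| ≤ B) :
    Tendsto (fun p : Σ N, ℕ → Fin N → Θ => genMean f 0 p.2) (inProb fun N => M.law N 0)
      (𝓝 (∫ θ, f θ ∂M.prior)) := by
  have := M.prior_prob
  refine (tendsto_inProb_iff (X := fun _ x => genMean f 0 x)).2 fun ε hε => ?_
  refine tendsto_of_tendsto_of_tendsto_of_le_of_le' tendsto_const_nhds
    (tendsto_ofReal_const_div_nat (B ^ 2 / ε ^ 2)) (Eventually.of_forall fun _ => zero_le) ?_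
  filter_upwards [eventually_gt_atTop 0] with N hN
  rw [law, Measure.map_apply (show Measurable fun (y : Fin N → Θ) (_ : ℕ) => y from
      measurable_pi_lambda _ fun _ => measurable_id)
    (measurableSet_le measurable_const ((measurable_genMean hf _).sub_const _).abs)]
  exact measure_pi_mean_sub_integral_ge_le M.prior hf hB hN hε

/-- Consistency of the unweighted means over each generation. -/
theorem tendsto_genMean (M : PSModel Θ) (h0 : M.β 0 = 0) {T : ℕ} {C : ℝ}
    (hC : ∀ r ≤ T, ∀ θ, M.L θ ^ M.β r ≤ C) (hZ0 : M.Z 0 = 1) (hZ : ∀ r, 0 ≤ M.Z r)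
    (hZpos : ∀ r ≤ T, 0 < M.Z r) (hK : ∀ t ≤ T, Kernel.Invariant (M.K t) (M.target t))
    {t : ℕ} (ht : t ≤ T) : ∀ s ≤ t, ∀ f : Θ → ℝ, Measurable f → (∃ B : ℝ, ∀ θ, |f θ| ≤ B) →
      Tendsto (fun p : Σ N, ℕ → Fin N → Θ => genMean f s p.2) (inProb fun N => M.law N t)
        (𝓝 (∫ θ, f θ ∂M.target s)) := by
  have := M.prior_prob
  induction t with
  | zero =>
    rintro s hs f hf ⟨B, hB⟩
    obtain rfl := Nat.le_zero.1 hs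
    rw [M.target_eq_prior h0]
    exact M.tendsto_genMean_law_zero hf hB
  | succ t ih =>
    rintro s hs f hf ⟨B, hB⟩
    have ih := ih (by omega)
    rcases Nat.lt_or_ge t s with hst | hst
    · obtain rfl : s = t + 1 := by omega
      have hmK := M.markov_K (t + 1)
      have hKf := measurable_integral_kernel (M.K (t + 1)) hf
      have hKB : ∀ θ, |∫ η, f η ∂(M.K (t + 1) θ)| ≤ B := fun θ =>
        abs_integral_le_of_bounded _ hB
      have hest := M.tendsto_estimator h0 (fun r hr => hC r (by omega)) hZ0 hZ
        (fun r hr => hZpos r (by omega)) ih hKf hKB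
      have hfin : IsFiniteMeasure (M.target (t + 1)) := by
        refine isFiniteMeasure_withDensity_ofReal ?_
        refine (Integrable.of_bound ?_ (C * |(M.Z (t + 1))⁻¹|) (ae_of_all _ fun θ => ?_)).2
        · exact ((M.measurable_L.pow_const _).div_const _).aestronglyMeasurable
        · have hp := Real.rpow_pos_of_pos (M.L_pos θ) (M.β (t + 1))
          rw [div_eq_mul_inv, Real.norm_eq_abs, abs_mul, abs_of_pos hp]
          have := hC (t + 1) ht θ
          gcongr
      -- Invariance enters here: the move does not change the limit.
      have hinv : ∫ θ, ∫ η, f η ∂(M.K (t + 1) θ) ∂M.target (t + 1) =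
          ∫ θ, f θ ∂M.target (t + 1) := by
        rw [← integral_bind_kernel _ _ hf hB, (hK (t + 1) ht).def]
      rw [hinv] at hest
      refine (tendsto_inProb_iff (X := fun _ x => genMean f (t + 1) x)).2 fun ε hε => ?_
      have hsum := ((tendsto_inProb_iff (X := fun _ x => M.estimator x (t + 1) fun θ =>
        ∫ η, f η ∂(M.K (t + 1) θ))).1 hest (ε / 2) (half_pos hε)).add
        (tendsto_ofReal_const_div_nat (B ^ 2 / (ε / 2) ^ 2))
      rw [add_zero] at hsum
      refine tendsto_of_tendsto_of_tendsto_of_le_of_le' tendsto_const_nhds hsum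
        (Eventually.of_forall fun _ => zero_le) ?_
      filter_upwards [eventually_gt_atTop 0] with N hN
      exact M.law_succ_genMean_ge_le hN hf hB hε
    · exact M.tendsto_genMean_law_succ hst hf (ih s hst f hf ⟨B, hB⟩)

end PSModel

/-- Consistency of posterior expectations in persistent sampling. With iterations numbered from
`0`, the last of the `T` iterations has index `T - 1`. -/
theorem mainTheorem2 {Θ : Type*} [MeasurableSpace Θ] (M : PSModel Θ) (T : ℕ) (hT : 2 ≤ T)
    (hβ_first : M.β 0 = 0) (hβ_last : M.β (T - 1) = 1)
    (hK : ∀ t < T, Kernel.Invariant (M.K t) (M.target t))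
    (hC1 : M.LikelihoodRatioBounded T)
    (hC2 : M.NormalizingConstantPositive T)
    (hC3 : M.KernelRegular T)
    (hC4 : M.ScheduleRegular T)
    (f : Θ → ℝ) (hf : Measurable f) (hC5 : ∃ B : ℝ, ∀ θ, |f θ| ≤ B) :
    ∀ ε : ℝ, 0 < ε →
      Tendsto
        (fun N : ℕ => M.law N (T - 1)
          {x | ε ≤ |M.estimator x (T - 1) f - ∫ θ, f θ ∂M.posterior|})
        atTop (𝓝 0) := by
  obtain ⟨n, rfl⟩ : ∃ n, T = n + 2 := ⟨T - 2, by omega⟩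
  obtain ⟨B, hB⟩ := hC5
  obtain ⟨ε₀, hε₀, hε₀Z⟩ := hC2
  have := M.prior_prob
  -- (C1) with `s = 0` bounds `L ^ β_t` itself, as `L ^ β_0 = 1`; finitely many `t` allow a common
  -- `C`.
  have hC1' : ∀ t : Fin (n + 2), ∃ C : ℝ, ∀ θ, M.L θ ^ M.β t ≤ C := fun t => by
    simpa [hβ_first] using hC1 t t.2 0 (by omega)
  choose c hc using hC1'
  obtain ⟨C, hCc⟩ := (Set.finite_range c).bddAbove
  have hC : ∀ r ≤ n + 1, ∀ θ, M.L θ ^ M.β r ≤ C := fun r hr θ =>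
    (hc ⟨r, by omega⟩ θ).trans (hCc ⟨_, rfl⟩)
  have hZ : ∀ r, 0 ≤ M.Z r := fun r => integral_nonneg fun θ => Real.rpow_nonneg (M.L_pos θ).le _
  have hZ0 : M.Z 0 = 1 := by simp [PSModel.Z, hβ_first]
  have hZpos : ∀ r ≤ n + 1, 0 < M.Z r := fun r hr => hε₀.trans_le (hε₀Z r (by omega))
  have hgen := M.tendsto_genMean hβ_first hC hZ0 hZ hZpos (fun t ht => hK t (by omega)) le_rfl
  -- The law includes generation `n + 1`, but the estimator uses only generations up to `n`.
  have hest := M.tendsto_estimator hβ_first hC hZ0 hZ hZpos (fun s hs => hgen s (by omega)) hf hB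
  rw [M.target_eq_posterior (t := n + 1) hβ_last] at hest
  exact (tendsto_inProb_iff (X := fun _ x => M.estimator x (n + 1) f)).1 hest
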